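/- Let $(X_t,J_t)_{t\ge 0}$, $X_0=0$, be a spectrally positive Markov additive process: $J$ is an irreducible continuous-time Markov chain on $\{1,\dots,d\}$ with transition rate matrix $(q_{ij})$ and stationary distribution $\pi$; while $J$ is in state $i$, $X$ evolves as a Lévy process $X^{(i)}$ with only upward jumps; and at the $n$-th transition epoch of $J$, if it is a transition from $i$ to $j$, $X$ has an additional jump $U^n_{ij}\ge 0$, the $(U^n_{ij})_n$ being i.i.d. copies of $U_{ij}$; $J$, the $X^{(i)}$ and the $U^n_{ij}$ are independent. Assume stability: the means $\mathbb E X_1^{(i)}$ and $\mathbb E U_{ij}$ (for $q_{ij}>0$, $i\ne j$) are finite and $\sum_i\pi_i\,\mathbb E X_1^{(i)}+\sum_{i\neq j}\pi_iq_{ij}\,\mathbb E U_{ij}<0$. Let $Q_t=X_t+\max\{Q_0,-\inf_{0\le u\le t}X_u\}$, $t\ge 0$, be the workload, in stationarity: $Q_0\ge 0$ is conditionally independent of $(X_t,J_t)_{t\ge 0}$ given $J_0$, and $(Q_t,J_t)$ has the same law for every $t\ge 0$. Assume $\mathbb E Q_0^2<\infty$. Write $\mathbb E_i=\mathbb E(\,\cdot\mid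 J_0=i)$ and $\tau(y)=\inf\{t\ge 0: X_t\le -y\}$, with $e^{-\vartheta\cdot\infty}=0$. For complex $\alpha$ with $\operatorname{Re}\alpha\ge 0$ put $\kappa(\alpha)=\mathbb E\,e^{-\alpha Q_0}$ and $\kappa_i(\alpha)=\mathbb E(e^{-\alpha Q_0}1_{\{J_0=i\}})$; derivatives are taken within the closed right half-plane (so they are one-sided at $0$). Let $\vartheta>0$, let $T$ be exponentially distributed with rate $\vartheta$, independent of $(Q_0,X,J)$, and put $\nu_i(\vartheta)=\mathbb E_iX_T$, $\gamma(\vartheta)=\mathrm{Cov}(Q_0,Q_T)$. Suppose that there are complex numbers $c_{ij}(\vartheta)$, $\psi_j(\vartheta)$ $(1\le i,j\le d)$ with $$\mathbb E_i\,e^{-\vartheta\tau(y)}=\sum_{j=1}^d c_{ij}(\vartheta)\,e^{-\psi_j(\vartheta)y}\qquad\text{for all } y>0 \text{ and all } i.$$ Then $\mathbb E Q_T^2<\infty$, $\mathbb E_i|X_T|<\infty$ for every $i$, and $$\gamma(\vartheta)=\kappa''(0)-(\kappa'(0))^2-\sum_{i=1}^d\sum_{j=1}^d\frac{c_{ij}(\vartheta)}{\psi_j(\vartheta)}\,\kappa_i'(\psi_j(\vartheta))-\sum_{i=1}^d\nu_i(\vartheta)\,\kappa_i'(0).$$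 (Terms with $\operatorname{Re}\psi_j(\vartheta)\le 0$ necessarily cancel in the expansion and are then to be omitted in the formula.) Moreover, if $\mathrm{Var}\,Q_0>0$, then, with $r(t)$ the correlation coefficient of $Q_0$ and $Q_t$, $$\int_0^\infty e^{-\vartheta t}\,r(t)\,dt=\frac{\gamma(\vartheta)}{\vartheta\,\mathrm{Var}\,Q_0},$$ the integral being absolutely convergent. -/

import Mathlib

open MeasureTheory ProbabilityTheory Filter Topology Set
open scoped NNReal ENNReal Matrix

noncomputable section

namespace SPMap

variable {Ω : Type*} [MeasurableSpace Ω] {d : ℕ}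

/-- Right-continuous paths with left limits, indexed by `[0, ∞)`. -/
def IsCadlag {E : Type*} [TopologicalSpace E] (x : ℝ≥0 → E) : Prop :=
  ∀ t : ℝ≥0, ContinuousWithinAt x (Ici t) t ∧ ∃ l : E, Tendsto x (𝓝[<] t) (𝓝 l)

/-- Lévy processes on `[0, ∞)`. -/
structure IsLevy (Y : ℝ≥0 → Ω → ℝ) (μ : Measure Ω) : Prop where
  measurable : ∀ t, Measurable (Y t)
  cadlag : ∀ ω, IsCadlag (fun t => Y t ω)
  zero : ∀ ω, Y 0 ω = 0
  indep_increments : HasIndepIncrements Y μ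
  stationary_increments :
    ∀ s t : ℝ≥0, IdentDistrib (fun ω => Y (s + t) ω - Y s ω) (Y t) μ μ

/-- Almost surely, all jumps are upward (`Function.leftLim` is the left limit; at time `0` it is
the value at `0`). -/
def IsSpectrallyPositive (Y : ℝ≥0 → Ω → ℝ) (μ : Measure Ω) : Prop :=
  ∀ᵐ ω ∂μ, ∀ t : ℝ≥0, Function.leftLim (fun s => Y s ω) t ≤ Y t ω

/-- Irreducible transition rate matrices of a finite-state continuous-time Markov chain. -/
structure IsIrreducibleRateMatrix (q : Matrix (Fin d) (Fin d) ℝ) : Prop where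
  nonneg : ∀ i j, i ≠ j → 0 ≤ q i j
  row_sum : ∀ i, ∑ j, q i j = 0
  irreducible : ∀ i j, Relation.ReflTransGen (fun a b => 0 < q a b) i j

/-- Continuous-time Markov chains (càdlàg, arbitrary initial law) with transition rate matrix `q`:
the transition probabilities over a period `h` are the entries of `exp (h q)`. -/
structure IsMarkovChain (q : Matrix (Fin d) (Fin d) ℝ) (J : ℝ≥0 → Ω → Fin d) (μ : Measure Ω) :
    Prop where
  measurable : ∀ t, Measurable (J t)
  cadlag : ∀ ω, IsCadlag (fun t => J t ω)
  fdd : ∀ (n : ℕ) (t : Fin (n + 1) → ℝ≥0), Monotone t → ∀ i : Fin (n + 1) → Fin d,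
    μ.real {ω | ∀ k, J (t k) ω = i k} =
      μ.real {ω | J (t 0) ω = i 0} *
        ∏ k : Fin n, (NormedSpace.exp (((t k.succ : ℝ) - (t k.castSucc : ℝ)) • q) :
          Matrix (Fin d) (Fin d) ℝ) (i k.castSucc) (i k.succ)

/-- The transition epochs of a path of the background process. -/
def transitionTimes (j : ℝ≥0 → Fin d) : Set ℝ≥0 :=
  {t | Function.leftLim j t ≠ j t}

/-- The number of transition epochs in `(0, t]`. -/
def transitionCount (j : ℝ≥0 → Fin d) (t : ℝ≥0) : ℕ :=
  (transitionTimes j ∩ Ioc 0 t).ncard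

/-- `(X, J)` is the spectrally positive Markov additive process, started from `X 0 = 0`, that is
built from the background chain `J` with rate matrix `q`, the spectrally positive Lévy processes
`Y i` and the nonnegative jumps `U i j n` at transition epochs: while `J` stays in state `j`, the
process `X` has the increments of `Y j`, and if the `n`-th transition epoch is one from `i` to `j`,
then `X` has the jump `U i j n` there. These relations determine `X` from `J`, `Y` and `U`. -/
structure IsSPMap (q : Matrix (Fin d) (Fin d) ℝ) (Y : Fin d → ℝ≥0 → Ω → ℝ)
    (U : Fin d → Fin d → ℕ → Ω → ℝ) (J : ℝ≥0 → Ω → Fin d) (X : ℝ≥0 → Ω → ℝ)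
    (μ : Measure Ω) : Prop where
  rates : IsIrreducibleRateMatrix q
  chain : IsMarkovChain q J μ
  levy : ∀ i, IsLevy (Y i) μ
  spectrally_positive : ∀ i, IsSpectrallyPositive (Y i) μ
  jump_measurable : ∀ i j n, Measurable (U i j n)
  jump_law : ∀ i j n, IdentDistrib (U i j n) (U i j 0) μ μ
  jump_nonneg : ∀ i j n, ∀ᵐ ω ∂μ, 0 ≤ U i j n ω
  -- the chain, the Lévy processes and the jumps are all independent
  indep_levy : iIndepFun (fun i ω => fun t => Y i t ω) μ
  indep_jump : iIndepFun (fun (p : Fin d × Fin d × ℕ) ω => U p.1 p.2.1 p.2.2 ω) μ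
  indep_levy_jump : IndepFun (fun ω => fun i t => Y i t ω) (fun ω => fun i j n => U i j n ω) μ
  indep_chain : IndepFun (fun ω => fun t => J t ω)
    (fun ω => ((fun i t => Y i t ω), (fun i j n => U i j n ω))) μ
  -- the additive component
  measurable : ∀ t, Measurable (X t)
  zero : ∀ ω, X 0 ω = 0
  sojourn : ∀ ω, ∀ s t : ℝ≥0, s ≤ t → (∀ u ∈ Icc s t, J u ω = J s ω) →
    X t ω - X s ω = Y (J s ω) t ω - Y (J s ω) s ω
  transition : ∀ ω, ∀ t ∈ transitionTimes (fun u => J u ω),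
    X t ω = Function.leftLim (fun u => X u ω) t +
      U (Function.leftLim (fun u => J u ω) t) (J t ω) (transitionCount (fun u => J u ω) t) ω

/-- The mean drift condition: all means that enter the drift are finite, and the drift, averaged
with respect to the stationary distribution `p` of the background chain, is negative. -/
def IsStable (q : Matrix (Fin d) (Fin d) ℝ) (Y : Fin d → ℝ≥0 → Ω → ℝ)
    (U : Fin d → Fin d → ℕ → Ω → ℝ) (p : Fin d → ℝ) (μ : Measure Ω) : Prop :=
  (∀ i, Integrable (Y i 1) μ) ∧
  (∀ i j, i ≠ j → q i j ≠ 0 → Integrable (U i j 0) μ) ∧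
  (∑ i, p i * (∫ ω, Y i 1 ω ∂μ)) +
    (∑ i, ∑ j ∈ Finset.univ.erase i, p i * q i j * (∫ ω, U i j 0 ω ∂μ)) < 0

/-- The workload at time `t`, for initial workload `Q₀` and input process `X`. -/
def workload (Q₀ : Ω → ℝ) (X : ℝ≥0 → Ω → ℝ) (t : ℝ≥0) (ω : Ω) : ℝ :=
  X t ω + max (Q₀ ω) (-sInf ((fun u => X u ω) '' Icc 0 t))

/-- `Q₀` is the initial workload of a stationary queue with input process `(X, J)`: it is
nonnegative, it is conditionally independent of the input process given the initial background
state, and workload and background state jointly have a time-independent law. -/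
structure IsStationaryWorkload (Q₀ : Ω → ℝ) (J : ℝ≥0 → Ω → Fin d) (X : ℝ≥0 → Ω → ℝ)
    (μ : Measure Ω) : Prop where
  measurable : Measurable Q₀
  nonneg : ∀ᵐ ω ∂μ, 0 ≤ Q₀ ω
  cond_indep : ∀ i, IndepFun Q₀ (fun ω => ((fun t => X t ω), (fun t => J t ω)))
    (cond μ (J 0 ⁻¹' {i}))
  stationary : ∀ t : ℝ≥0, IdentDistrib (fun ω => (workload Q₀ X t ω, J t ω))
    (fun ω => (Q₀ ω, J 0 ω)) μ μ

/-- The first passage time `inf {t ≥ 0 : x t ≤ -y}` of a path, infinite if there is no such `t`. -/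
def firstPassage (x : ℝ≥0 → ℝ) (y : ℝ) : ℝ≥0∞ :=
  sInf ((fun t : ℝ≥0 => (t : ℝ≥0∞)) '' {t | x t ≤ -y})

/-- `exp (-θ τ)`, which is `0` for `τ = ∞`. -/
def discount (θ : ℝ) (τ : ℝ≥0∞) : ℝ :=
  if τ = ⊤ then 0 else Real.exp (-(θ * τ.toReal))

/-- The expectation of `exp (-θ τ(y))` given that the background process starts in `i`. -/
def xi (J : ℝ≥0 → Ω → Fin d) (X : ℝ≥0 → Ω → ℝ) (μ : Measure Ω) (θ : ℝ) (i : Fin d) (y : ℝ) : ℝ :=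
  ∫ ω, discount θ (firstPassage (fun t => X t ω) y) ∂(cond μ (J 0 ⁻¹' {i}))

/-- The Laplace transform of `Q₀`, on complex arguments. -/
def kappa (Q₀ : Ω → ℝ) (μ : Measure Ω) (a : ℂ) : ℂ :=
  ∫ ω, Complex.exp (-a * Q₀ ω) ∂μ

/-- The Laplace transform of `Q₀` on the event that the background process starts in `i`. -/
def kappaState (Q₀ : Ω → ℝ) (J : ℝ≥0 → Ω → Fin d) (μ : Measure Ω) (i : Fin d) (a : ℂ) : ℂ :=
  ∫ ω in J 0 ⁻¹' {i}, Complex.exp (-a * Q₀ ω) ∂μ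

/-- The derivative of a function on the closed right half-plane, one-sided on the boundary. -/
def hpDeriv (f : ℂ → ℂ) (a : ℂ) : ℂ :=
  derivWithin f {z : ℂ | 0 ≤ z.re} a

/-- The expectation of `X_T` given that the background process starts in `i`. -/
def nu (J : ℝ≥0 → Ω → Fin d) (X : ℝ≥0 → Ω → ℝ) (T : Ω → ℝ≥0) (μ : Measure Ω) (i : Fin d) : ℝ :=
  ∫ ω, X (T ω) ω ∂(cond μ (J 0 ⁻¹' {i}))

/-- `T` is exponentially distributed with rate `θ`, and independent of the queue. -/
structure IsIndepExponential (θ : ℝ) (T : Ω → ℝ≥0) (Q₀ : Ω → ℝ) (J : ℝ≥0 → Ω → Fin d)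
    (X : ℝ≥0 → Ω → ℝ) (μ : Measure Ω) : Prop where
  measurable : Measurable T
  law : μ.map (fun ω => (T ω : ℝ)) = expMeasure θ
  indep : IndepFun T (fun ω => (Q₀ ω, (fun t => X t ω), (fun t => J t ω))) μ

/-- The covariance of the workloads at time `0` and at the exponential time `T`. -/
def gammaCov (Q₀ : Ω → ℝ) (X : ℝ≥0 → Ω → ℝ) (T : Ω → ℝ≥0) (μ : Measure Ω) : ℝ :=
  covariance Q₀ (fun ω => workload Q₀ X (T ω) ω) μ

/-- The correlation coefficient of the workloads at times `0` and `t`. -/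
def corr (Q₀ : Ω → ℝ) (X : ℝ≥0 → Ω → ℝ) (μ : Measure Ω) (t : ℝ≥0) : ℝ :=
  covariance Q₀ (workload Q₀ X t) μ / √(variance Q₀ μ * variance (workload Q₀ X t) μ)

end SPMap

end

/-!
Let `L t = -inf_{u ≤ t} X u` be the depth of the input, so that `Q t = X t + max Q₀ (L t)` and

  `E[Q₀ Q_T] = E[Q₀ X_T] + E[Q₀ ^ 2] + E[Q₀ (L_T - Q₀)⁺]`.

Given `J 0 = i`, the pair `(X_T, L_T)` is independent of `Q₀` (`indepFun_input_at_time`). So the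
first term is a sum of products of `ν_i` and `-κ_i'(0)`, and the last one is governed by the expected
excess of `L_T` over a level. Since paths are right-continuous, `{L_T > y}` and `{τ(y) ≤ T}` differ
by a subset of `{L_T = y}`, which is a null event for all but countably many `y`, and an exponential
time survives `τ(y)` with probability `exp (-θ τ(y))`; hence the tail of `L_T` is the given
exponential sum (`integral_discount_firstPassage`). A tail vanishes at infinity, which forces the
non-decaying terms to cancel (`sum_mul_eq_sum_filter_re_pos`); integrating the others gives
`E_i (L_T - x)⁺ = ∑ j, c_ij / ψ_j exp (-ψ_j x)` (`integral_excess_of_tail`), and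
`E[Q₀ exp (-ψ Q₀); J 0 = i]` is `-κ_i'(ψ)` on the closed half-plane (`hasDerivWithinAt_laplace`).

The moments are finite because `Q_T` has the law of `Q₀` by stationarity, and because
`-L_T ≤ X_T ≤ Q_T`, where `L_T` has an integrable tail. The formula for the correlation
coefficient `r` is Fubini's theorem for the time `T`, as `r(t) Var Q₀ = E[Q₀ Q_t] - (E Q₀)²`.
-/

namespace SPMap

/-! ### Paths with right limits: infima and first passage times -/

/-- The depth `-inf_{u ≤ t} x u` of a path below `0` up to time `t`. -/
noncomputable def depth (x : ℝ≥0 → ℝ) (t : ℝ≥0) : ℝ :=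
  -sInf (x '' Icc 0 t)

lemma IsCadlag.bddBelow {x : ℝ≥0 → ℝ} (hx : IsCadlag x) (t : ℝ≥0) :
    BddBelow (x '' Icc 0 t) := by
  have loc : ∀ {F : Filter ℝ≥0} {l : ℝ}, Tendsto x F (𝓝 l) → ∃ V ∈ F, BddBelow (x '' V) := by
    intro F l h
    refine ⟨_, h (Ioi_mem_nhds (sub_one_lt l)), l - 1, ?_⟩
    rintro _ ⟨u, hu, rfl⟩
    exact le_of_lt hu
  refine isCompact_Icc.induction_on (p := fun s => BddBelow (x '' s)) (by simp)
    (fun s u hsu hu => hu.mono (image_mono hsu))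
    (fun s u hs hu => by rw [image_union]; exact hs.union hu) fun u _ => ?_
  obtain ⟨hr, l, hl⟩ := hx u
  obtain ⟨V, hV, bV⟩ := loc hr
  obtain ⟨W, hW, bW⟩ := loc hl
  refine ⟨W ∪ V, mem_nhdsWithin_of_mem_nhds ?_, by rw [image_union]; exact bW.union bV⟩
  rw [← nhdsLT_sup_nhdsGE]
  exact union_mem_sup hW hV

lemma neg_le_depth {x : ℝ≥0 → ℝ} (hx : IsCadlag x) {u t : ℝ≥0} (hut : u ≤ t) :
    -x u ≤ depth x t :=
  neg_le_neg (csInf_le (hx.bddBelow t) ⟨u, ⟨zero_le, hut⟩, rfl⟩)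

lemma lt_depth_iff {x : ℝ≥0 → ℝ} (hx : IsCadlag x) {t : ℝ≥0} {y : ℝ} :
    y < depth x t ↔ ∃ u ≤ t, x u < -y := by
  rw [depth, lt_neg, csInf_lt_iff (hx.bddBelow t) ⟨x 0, 0, ⟨le_rfl, zero_le⟩, rfl⟩]
  constructor
  · rintro ⟨_, ⟨u, hu, rfl⟩, h⟩
    exact ⟨u, hu.2, h⟩
  · rintro ⟨u, hu, h⟩
    exact ⟨_, ⟨u, ⟨zero_le, hu⟩, rfl⟩, h⟩

lemma depth_nonneg {x : ℝ≥0 → ℝ} (hx : IsCadlag x) (h0 : x 0 = 0) (t : ℝ≥0) : 0 ≤ depth x t := by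
  simpa [h0] using neg_le_depth hx (zero_le (a := t))

lemma firstPassage_le_of_lt_depth {x : ℝ≥0 → ℝ} (hx : IsCadlag x) {t : ℝ≥0} {y : ℝ}
    (h : y < depth x t) : firstPassage x y ≤ t := by
  obtain ⟨u, hu, h⟩ := (lt_depth_iff hx).1 h
  have : firstPassage x y ≤ u := sInf_le ⟨u, h.le, rfl⟩
  exact this.trans (ENNReal.coe_le_coe.2 hu)

/-- By right-continuity, the level is reached at the first passage time. -/
lemma le_depth_of_firstPassage_le {x : ℝ≥0 → ℝ} (hx : IsCadlag x) {t : ℝ≥0} {y : ℝ}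
    (h : firstPassage x y ≤ t) : y ≤ depth x t := by
  by_contra! hlt
  have key : ∀ u ≤ t, -y < x u := fun u hu => by linarith [neg_le_depth hx hu]
  have hev : ∀ᶠ u in 𝓝[≥] t, -y < x u := (hx t).1 (Ioi_mem_nhds (key t le_rfl))
  obtain ⟨s, hs, hsub⟩ := mem_nhdsGE_iff_exists_Ico_subset.1 hev
  have hs' : t < s := hs
  have : (s : ℝ≥0∞) ≤ firstPassage x y := by
    refine le_sInf ?_
    rintro _ ⟨u, hu, rfl⟩
    by_contra! hus
    have hus' : u < s := by exact_mod_cast hus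
    have : -y < x u := by
      rcases le_total u t with h1 | h1
      · exact key u h1
      · exact hsub ⟨h1, hus'⟩
    exact absurd hu (not_le.2 this)
  have : (s : ℝ≥0∞) ≤ t := this.trans h
  exact absurd (by exact_mod_cast this) (not_le.2 hs')

/-- Away from its transition epochs, the additive component moves with one of the Lévy processes,
so it inherits the path regularity of these; the transition epochs have no accumulation point. -/
lemma IsSPMap.isCadlag {Ω : Type*} [MeasurableSpace Ω] {d : ℕ} {q : Matrix (Fin d) (Fin d) ℝ}
    {Y : Fin d → ℝ≥0 → Ω → ℝ} {U : Fin d → Fin d → ℕ → Ω → ℝ} {J : ℝ≥0 → Ω → Fin d}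
    {X : ℝ≥0 → Ω → ℝ} {μ : Measure Ω} (h : IsSPMap q Y U J X μ) (ω : Ω) :
    IsCadlag (fun t => X t ω) := by
  intro t
  obtain ⟨hJr, l, hJl⟩ := h.chain.cadlag ω t
  constructor
  · have hev : ∀ᶠ u in 𝓝[≥] t, J u ω = J t ω :=
      hJr.tendsto.eventually (mem_nhds_discrete.2 (mem_singleton _))
    obtain ⟨s, hs, hsub⟩ := mem_nhdsGE_iff_exists_Ico_subset.1 hev
    have hs' : t < s := hs
    have hY := ((h.levy (J t ω)).cadlag ω t).1
    have : ContinuousWithinAt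
        (fun u => X t ω + (Y (J t ω) u ω - Y (J t ω) t ω)) (Ici t) t :=
      continuousWithinAt_const.add (hY.sub continuousWithinAt_const)
    refine this.congr_of_eventuallyEq ?_ (by simp)
    filter_upwards [Ico_mem_nhdsGE hs'] with u hu
    have := h.sojourn ω t u hu.1 fun v hv => hsub ⟨hv.1, hv.2.trans_lt hu.2⟩
    linarith
  · rcases eq_or_ne t 0 with rfl | ht
    · refine ⟨0, ?_⟩
      rw [show Iio (0 : ℝ≥0) = ∅ from by ext; simp]
      simp
    have hev : ∀ᶠ u in 𝓝[<] t, J u ω = l :=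
      hJl.eventually (mem_nhds_discrete.2 (mem_singleton _))
    obtain ⟨r, hr, hsub⟩ := (mem_nhdsLT_iff_exists_Ioo_subset' (pos_iff_ne_zero.2 ht)).1 hev
    have hr' : r < t := hr
    obtain ⟨s, hrs, hst⟩ := exists_between hr'
    have hJs : J s ω = l := hsub ⟨hrs, hst⟩
    obtain ⟨m, hm⟩ := ((h.levy l).cadlag ω t).2
    refine ⟨X s ω + (m - Y l s ω), ?_⟩
    refine Tendsto.congr' ?_ (tendsto_const_nhds.add (hm.sub tendsto_const_nhds))
    filter_upwards [Ico_mem_nhdsLT hst] with u hu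
    have := h.sojourn ω s u hu.1 fun v hv => by
      rw [hJs]; exact hsub ⟨hrs.trans_le hv.1, hv.2.trans_lt hu.2⟩
    rw [hJs] at this
    linarith

/-! ### Measurability in time and outcome -/

lemma measurable_uncurry_of_cadlag {S : Type*} [MeasurableSpace S] {X : ℝ≥0 → S → ℝ}
    (hm : ∀ t, Measurable (X t)) (hc : ∀ s, IsCadlag fun t => X t s) :
    Measurable (Function.uncurry X) := by
  -- the value at `t` is the limit of the values at the next point of finer and finer grids
  let g : ℕ → ℝ≥0 → ℝ≥0 := fun n t => ((⌊t * (n + 1)⌋₊ + 1 : ℕ) : ℝ≥0) / (n + 1)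
  refine measurable_of_tendsto_metrizable (f := fun n p => X (g n p.1) p.2) (fun n => ?_)
    (tendsto_pi_nhds.2 fun p => ?_)
  · have h1 : Measurable fun p : ℕ × S => X (((p.1 + 1 : ℕ) : ℝ≥0) / (n + 1)) p.2 :=
      measurable_from_prod_countable_right fun k => hm (((k + 1 : ℕ) : ℝ≥0) / (n + 1))
    have h2 : Measurable fun p : ℝ≥0 × S => (⌊p.1 * (n + 1)⌋₊, p.2) :=
      (Nat.measurable_floor.comp (measurable_fst.mul_const _)).prodMk measurable_snd
    exact h1.comp h2
  · have hlow : ∀ n : ℕ, p.1 ≤ g n p.1 := fun n => by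
      rw [le_div_iff₀ (by positivity)]
      push_cast
      exact (Nat.lt_floor_add_one _).le
    have hup : ∀ n : ℕ, g n p.1 ≤ p.1 + 1 / ((n : ℝ≥0) + 1) := fun n => by
      rw [div_le_iff₀ (by positivity), add_mul, one_div, inv_mul_cancel₀ (by positivity)]
      push_cast
      gcongr
      exact Nat.floor_le (by positivity)
    have hlim : Tendsto (fun n => g n p.1) atTop (𝓝 p.1) := by
      refine tendsto_of_tendsto_of_tendsto_of_le_of_le tendsto_const_nhds ?_ hlow hup
      simpa using tendsto_const_nhds.add (tendsto_one_div_add_atTop_nhds_zero_nat (𝕜 := ℝ≥0))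
    exact (hc p.2 p.1).1.tendsto.comp
      (tendsto_nhdsWithin_iff.2 ⟨hlim, Eventually.of_forall hlow⟩)

lemma measurable_uncurry_depth {S : Type*} [MeasurableSpace S] {X : ℝ≥0 → S → ℝ}
    (hm : ∀ t, Measurable (X t)) (hc : ∀ s, IsCadlag fun t => X t s) :
    Measurable fun p : ℝ≥0 × S => depth (fun t => X t p.2) p.1 := by
  obtain ⟨D, hDc, hD⟩ := TopologicalSpace.exists_countable_dense ℝ≥0
  refine measurable_of_Ioi fun y => ?_
  have : (fun p : ℝ≥0 × S => depth (fun t => X t p.2) p.1) ⁻¹' Ioi y =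
      {p | Function.uncurry X p < -y} ∪ ⋃ u ∈ D, {p : ℝ≥0 × S | u < p.1 ∧ X u p.2 < -y} := by
    ext p
    simp only [mem_preimage, mem_Ioi, lt_depth_iff (hc p.2), mem_union, mem_ofPred_eq, mem_iUnion,
      exists_prop, Function.uncurry]
    constructor
    · rintro ⟨u, hu, h⟩
      rcases hu.eq_or_lt with rfl | hlt
      · exact Or.inl h
      · right
        have hev : ∀ᶠ v in 𝓝[≥] u, X v p.2 < -y := (hc p.2 u).1 (Iio_mem_nhds h)
        obtain ⟨s, hs, hsub⟩ := mem_nhdsGE_iff_exists_Ico_subset.1 hev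
        obtain ⟨v, hvD, hv⟩ := hD.exists_between (lt_min (show u < s from hs) hlt)
        exact ⟨v, hvD, hv.2.trans_le (min_le_right _ _),
          hsub ⟨hv.1.le, hv.2.trans_le (min_le_left _ _)⟩⟩
    · rintro (h | ⟨u, -, hu, h⟩)
      · exact ⟨p.1, le_rfl, h⟩
      · exact ⟨u, hu.le, h⟩
  rw [this]
  refine (measurableSet_lt (measurable_uncurry_of_cadlag hm hc) measurable_const).union
    (MeasurableSet.biUnion hDc fun u _ => ?_)
  exact (measurableSet_lt measurable_const measurable_fst).inter
    (measurableSet_lt ((hm u).comp measurable_snd) measurable_const)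

/-! ### Vanishing exponential sums -/

lemma exists_exp_mul_ne {z w : ℂ} (h : z ≠ w) :
    ∃ s : ℝ, Complex.exp (-z * s) ≠ Complex.exp (-w * s) := by
  by_contra! H
  have hd : ∀ z : ℂ, HasDerivAt (fun s : ℝ => Complex.exp (-z * s)) (-z) 0 := by
    intro z
    have h1 : HasDerivAt (fun s : ℝ => -z * (s : ℂ)) (-z) 0 := by
      simpa using (Complex.ofRealCLM.hasDerivAt (x := (0 : ℝ))).const_mul (-z)
    simpa using h1.cexp
  exact h (neg_injective ((hd z).unique (funext H ▸ hd w)))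

/-- If a finite exponential sum vanishes at infinity, then its terms that do not decay are absent.
Combining the sum with its translates removes any one exponent, so that an induction on the number
of exponents applies. -/
lemma eq_zero_of_tendsto_sum_exp (S : Finset ℂ) : ∀ a : ℂ → ℂ,
    Tendsto (fun y : ℝ => ∑ z ∈ S, a z * Complex.exp (-z * y)) atTop (𝓝 0) →
      ∀ z ∈ S, z.re ≤ 0 → a z = 0 := by
  induction S using Finset.strongInduction with
  | H S ih =>
  intro a ha z hz hre
  by_cases h1 : ∃ w ∈ S, w ≠ z
  · obtain ⟨w, hw, hwz⟩ := h1
    obtain ⟨s, hs⟩ := exists_exp_mul_ne hwz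
    have key := ih (S.erase w) (Finset.erase_ssubset hw)
      (fun z => a z * (Complex.exp (-z * s) - Complex.exp (-w * s))) ?_ z
      (Finset.mem_erase.2 ⟨hwz.symm, hz⟩) hre
    · exact (mul_eq_zero.1 key).resolve_right (sub_ne_zero.2 hs.symm)
    · have h2 := (ha.comp (tendsto_atTop_add_const_right atTop s tendsto_id)).sub
        (ha.const_mul (Complex.exp (-w * s)))
      rw [mul_zero, sub_zero] at h2
      refine h2.congr fun y => ?_
      rw [Function.comp_apply, Finset.mul_sum, ← Finset.sum_sub_distrib,
        ← Finset.add_sum_erase _ _ hw]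
      have e : ∀ z : ℂ, Complex.exp (-z * ((y + s : ℝ) : ℂ)) =
          Complex.exp (-z * s) * Complex.exp (-z * y) := fun z => by
        rw [← Complex.exp_add]; congr 1; push_cast; ring
      simp only [id, e]
      rw [show a w * (Complex.exp (-w * s) * Complex.exp (-w * y)) -
        Complex.exp (-w * s) * (a w * Complex.exp (-w * y)) = 0 by ring, zero_add]
      exact Finset.sum_congr rfl fun z _ => by ring
  · push Not at h1
    obtain rfl : S = {z} := Finset.eq_singleton_iff_unique_mem.2 ⟨hz, h1⟩
    simp only [Finset.sum_singleton] at ha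
    have h2 : Tendsto (fun _ : ℝ => ‖a z‖) atTop (𝓝 0) := by
      refine squeeze_zero' (Eventually.of_forall fun _ => norm_nonneg _) ?_
        (tendsto_zero_iff_norm_tendsto_zero.1 ha)
      filter_upwards [eventually_ge_atTop 0] with y hy
      rw [norm_mul, Complex.norm_exp]
      refine le_mul_of_one_le_right (norm_nonneg _) (Real.one_le_exp ?_)
      simpa using mul_nonpos_of_nonpos_of_nonneg hre hy
    exact norm_eq_zero.1 (tendsto_nhds_unique tendsto_const_nhds h2)

/-- The non-decaying terms of an exponential sum that vanishes at infinity cancel, and they still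
do so after multiplication by any function of the exponent. -/
lemma sum_mul_eq_sum_filter_re_pos {ι : Type*} [Fintype ι] {c ψ : ι → ℂ}
    (h : Tendsto (fun y : ℝ => ∑ j, c j * Complex.exp (-ψ j * y)) atTop (𝓝 0)) (g : ℂ → ℂ) :
    ∑ j, c j * g (ψ j) = ∑ j with 0 < (ψ j).re, c j * g (ψ j) := by
  classical
  have group : ∀ g : ℂ → ℂ, ∀ p : ℂ → Prop, [DecidablePred p] →
      ∑ j with p (ψ j), c j * g (ψ j) =
        ∑ z ∈ (Finset.univ.image ψ) with p z, (∑ j with ψ j = z, c j) * g z := by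
    intro g p _
    rw [Finset.sum_filter, ← Finset.sum_fiberwise_of_maps_to (g := ψ) (t := Finset.univ.image ψ)
      (fun j _ => Finset.mem_image_of_mem _ (Finset.mem_univ j)), Finset.sum_filter]
    refine Finset.sum_congr rfl fun z _ => ?_
    rw [Finset.sum_mul]
    split_ifs with hp
    · refine Finset.sum_congr rfl fun j hj => ?_
      rw [(Finset.mem_filter.1 hj).2, if_pos hp]
    · refine Finset.sum_eq_zero fun j hj => ?_
      rw [(Finset.mem_filter.1 hj).2, if_neg hp]
  have h0 := eq_zero_of_tendsto_sum_exp (Finset.univ.image ψ) (fun z => ∑ j with ψ j = z, c j)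
    (h.congr fun y => by simpa using group (fun z => Complex.exp (-z * y)) fun _ => True)
  rw [← Finset.sum_filter_add_sum_filter_not Finset.univ (fun j => 0 < (ψ j).re),
    group g fun z => ¬ 0 < z.re, add_eq_left]
  refine Finset.sum_eq_zero fun z hz => ?_
  rw [Finset.mem_filter, not_lt] at hz
  rw [h0 z hz.1 hz.2, zero_mul]

/-! ### Laplace transforms on the closed right half-plane -/

lemma norm_exp_mul_le_one {z : ℂ} (hz : 0 ≤ z.re) {x : ℝ} (hx : 0 ≤ x) :
    ‖Complex.exp (-z * x)‖ ≤ 1 := by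
  rw [Complex.norm_exp, Real.exp_le_one_iff]
  simpa using mul_nonneg hz hx

lemma convex_re_nonneg : Convex ℝ {z : ℂ | 0 ≤ z.re} :=
  convex_halfSpace_re_ge 0

lemma uniqueDiffOn_re_nonneg : UniqueDiffOn ℂ {z : ℂ | 0 ≤ z.re} := by
  refine fun z hz => UniqueDiffWithinAt.mono_field (𝕜 := ℝ) ?_
  refine uniqueDiffWithinAt_convex convex_re_nonneg ⟨1, ?_⟩ (subset_closure hz)
  have : {z : ℂ | 0 < z.re} ⊆ interior {z : ℂ | 0 ≤ z.re} :=
    interior_maximal (fun z (hz : 0 < z.re) => hz.le) (isOpen_lt continuous_const Complex.continuous_re)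
  exact this (by simp)

/-- Differentiation under the integral sign, up to the boundary of the half-plane: the difference
quotients of `exp (-z x)` in `z` are bounded by `x`. -/
lemma hasDerivWithinAt_laplace {Ω : Type*} [MeasurableSpace Ω] {μ : Measure Ω} {Q g : Ω → ℝ}
    (hQ : Measurable Q) (hQ0 : ∀ᵐ ω ∂μ, 0 ≤ Q ω) (hg : Integrable g μ)
    (hgQ : Integrable (fun ω => g ω * Q ω) μ) {z : ℂ} (hz : 0 ≤ z.re) :
    HasDerivWithinAt (fun w : ℂ => ∫ ω, g ω * Complex.exp (-w * Q ω) ∂μ)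
      (-∫ ω, ((g ω * Q ω : ℝ) : ℂ) * Complex.exp (-z * Q ω) ∂μ) {w : ℂ | 0 ≤ w.re} z := by
  have hexp : ∀ w : ℂ, Measurable fun ω => Complex.exp (-w * Q ω) := fun w => by fun_prop
  have hint : ∀ w : ℂ, 0 ≤ w.re → Integrable (fun ω => (g ω : ℂ) * Complex.exp (-w * Q ω)) μ := by
    intro w hw
    refine hg.ofReal.mul_bdd (c := 1) (hexp w).aestronglyMeasurable ?_
    filter_upwards [hQ0] with ω hω using norm_exp_mul_le_one hw hω
  have hder : ∀ x : ℝ, ∀ w : ℂ, HasDerivAt (fun w : ℂ => Complex.exp (-w * x))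
      (-x * Complex.exp (-w * x)) w := fun x w => by
    have := ((hasDerivAt_id w).neg.mul_const (x : ℂ)).cexp
    simpa [mul_comm] using this
  rw [hasDerivWithinAt_iff_tendsto_slope, ← integral_neg]
  have h1 : Tendsto (fun w : ℂ => ∫ ω, (g ω : ℂ) *
      slope (fun w : ℂ => Complex.exp (-w * Q ω)) z w ∂μ) (𝓝[{w : ℂ | 0 ≤ w.re} \ {z}] z)
      (𝓝 (∫ ω, -(((g ω * Q ω : ℝ) : ℂ) * Complex.exp (-z * Q ω)) ∂μ)) := by
    refine tendsto_integral_filter_of_dominated_convergence (fun ω => ‖g ω * Q ω‖) ?_ ?_ hgQ.norm ?_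
    · refine Eventually.of_forall fun w => hg.ofReal.aestronglyMeasurable.mul ?_
      simp only [slope_def_module]
      exact (((hexp w).sub (hexp z)).const_smul (w - z)⁻¹).aestronglyMeasurable
    · filter_upwards [self_mem_nhdsWithin] with w hw
      filter_upwards [hQ0] with ω hω
      have hb : ‖Complex.exp (-w * Q ω) - Complex.exp (-z * Q ω)‖ ≤ Q ω * ‖w - z‖ := by
        refine convex_re_nonneg.norm_image_sub_le_of_norm_hasDerivWithin_le
          (f := fun w : ℂ => Complex.exp (-w * Q ω))
          (fun v _ => (hder (Q ω) v).hasDerivWithinAt) (fun v hv => ?_) hz hw.1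
        rw [norm_mul, norm_neg, Complex.norm_real, Real.norm_of_nonneg hω]
        exact mul_le_of_le_one_right hω (norm_exp_mul_le_one hv hω)
      have hne : 0 < ‖w - z‖ := norm_pos_iff.2 (sub_ne_zero.2 hw.2)
      rw [slope_def_module, norm_mul, norm_smul, norm_inv, Complex.norm_real, norm_mul,
        Real.norm_of_nonneg hω]
      gcongr
      rw [inv_mul_le_iff₀ hne]
      exact hb.trans_eq (mul_comm _ _)
    · filter_upwards with ω
      have hsub : {w : ℂ | 0 ≤ w.re} \ {z} ⊆ {z}ᶜ := fun w hw => hw.2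
      have := ((hder (Q ω) z).tendsto_slope.mono_left
        (nhdsWithin_mono z hsub)).const_mul (g ω : ℂ)
      convert this using 2
      push_cast; ring
  refine h1.congr' ?_
  filter_upwards [self_mem_nhdsWithin] with w hw
  simp only [slope_def_module, smul_eq_mul]
  rw [← integral_sub (hint w hw.1) (hint z hz), ← integral_const_mul]
  congr 1 with ω
  ring

/-! ### Evaluation at an independent random time -/

lemma map_prodMk_cond_eq_prod {Ω S R : Type*} [MeasurableSpace Ω] [MeasurableSpace S]
    [MeasurableSpace R] {μ : Measure Ω} [IsProbabilityMeasure μ] {T : Ω → R} (hT : Measurable T)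
    {φ : Ω → S} (hφ : Measurable φ) (hind : IndepFun T φ μ) {B : Set S} (hB : MeasurableSet B) :
    (cond μ (φ ⁻¹' B)).map (fun ω => (T ω, φ ω)) =
      (μ.map T).prod ((cond μ (φ ⁻¹' B)).map φ) := by
  symm
  refine Measure.prod_eq fun s t hs ht => ?_
  rw [Measure.map_apply (hT.prodMk hφ) (hs.prod ht), Measure.map_apply hT hs,
    Measure.map_apply hφ ht, cond_apply (hφ hB), cond_apply (hφ hB), ← preimage_inter,
    mul_left_comm, ← hind.measure_inter_preimage_eq_mul s (B ∩ t) hs (hB.inter ht)]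
  congr 2
  ext ω
  simp only [mem_inter_iff, mem_preimage, mem_prod]
  tauto

lemma identDistrib_comp_of_map_prodMk {Ω S R E : Type*} [MeasurableSpace Ω] [MeasurableSpace S]
    [MeasurableSpace R] [MeasurableSpace E] {ν : Measure Ω} [IsFiniteMeasure ν] {P : Measure R}
    [IsFiniteMeasure P] {T : Ω → R} (hT : Measurable T) {φ : Ω → S} (hφ : Measurable φ)
    (hprod : ν.map (fun ω => (T ω, φ ω)) = P.prod (ν.map φ)) {H : R × S → E} (hH : Measurable H) :
    IdentDistrib (fun ω => H (T ω, φ ω)) (fun p : R × Ω => H (p.1, φ p.2)) ν (P.prod ν) where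
  aemeasurable_fst := (hH.comp (hT.prodMk hφ)).aemeasurable
  aemeasurable_snd := (hH.comp (measurable_fst.prodMk (hφ.comp measurable_snd))).aemeasurable
  map_eq := by
    have h1 : ν.map (fun ω => H (T ω, φ ω)) = (ν.map fun ω => (T ω, φ ω)).map H :=
      (Measure.map_map hH (hT.prodMk hφ)).symm
    have h2 : (P.prod ν).map (fun p : R × Ω => H (p.1, φ p.2)) =
        ((P.prod ν).map (Prod.map id φ)).map H :=
      (Measure.map_map hH (measurable_id.prodMap hφ)).symm
    rw [h1, h2, hprod, ← Measure.map_prod_map P ν measurable_id hφ, Measure.map_id]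

/-- Initial workload, input and depth of the input, as a function of time and outcome. -/
noncomputable def workloadData {Ω : Type*} (Q₀ : Ω → ℝ) (X : ℝ≥0 → Ω → ℝ) (p : ℝ≥0 × Ω) :
    ℝ × ℝ × ℝ :=
  (Q₀ p.2, X p.1 p.2, depth (fun t => X t p.2) p.1)

lemma measurable_workloadData {Ω : Type*} [MeasurableSpace Ω] {Q₀ : Ω → ℝ} {X : ℝ≥0 → Ω → ℝ}
    (hQ : Measurable Q₀) (hX : ∀ t, Measurable (X t)) (hc : ∀ ω, IsCadlag fun t => X t ω) :
    Measurable (workloadData Q₀ X) :=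
  (hQ.comp measurable_snd).prodMk
    ((measurable_uncurry_of_cadlag hX hc).prodMk (measurable_uncurry_depth hX hc))

lemma workload_eq {Ω : Type*} (Q₀ : Ω → ℝ) (X : ℝ≥0 → Ω → ℝ) (t : ℝ≥0) (ω : Ω) :
    workload Q₀ X t ω = X t ω + max (Q₀ ω) (depth (fun t => X t ω) t) := rfl

lemma measurable_input {Ω : Type*} [MeasurableSpace Ω] {X : ℝ≥0 → Ω → ℝ}
    (hX : ∀ t, Measurable (X t)) (hc : ∀ ω, IsCadlag fun t => X t ω) (t : ℝ≥0) :
    Measurable fun ω => (X t ω, depth (fun t => X t ω) t) :=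
  (hX t).prodMk <| Measurable.comp (g := fun p : ℝ≥0 × Ω => depth (fun t => X t p.2) p.1)
    (f := Prod.mk t) (measurable_uncurry_depth hX hc) measurable_prodMk_left

section RandomTime

variable {Ω 𝒥 : Type*} {mΩ : MeasurableSpace Ω} [MeasurableSpace 𝒥] {μ : Measure Ω}
  [IsProbabilityMeasure μ] {Q₀ : Ω → ℝ} {X : ℝ≥0 → Ω → ℝ} {J : Ω → 𝒥} {T : Ω → ℝ≥0}

/-- Conditionally on an event that `J` determines, an independent time may be sampled separately.
The data depend on a whole path, but they are measurable with respect to the `σ`-algebra that the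
initial workload and the paths generate, and the time is independent of this `σ`-algebra. -/
lemma identDistrib_workloadData (hQ : Measurable Q₀) (hX : ∀ t, Measurable (X t))
    (hc : ∀ ω, IsCadlag fun t => X t ω) (hJ : Measurable J) (hT : Measurable T)
    (hind : IndepFun T (fun ω => (Q₀ ω, (fun t => X t ω), J ω)) μ)
    {B : Set 𝒥} (hB : MeasurableSet B) :
    IdentDistrib (fun ω => workloadData Q₀ X (T ω, ω)) (workloadData Q₀ X)
      (cond μ (J ⁻¹' B)) ((μ.map T).prod (cond μ (J ⁻¹' B))) := by
  -- instances for the ambient `σ`-algebra, before the smaller one `m` is in scope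
  have hP : IsFiniteMeasure (μ.map T) := inferInstance
  have hν : IsFiniteMeasure (cond μ (J ⁻¹' B)) := inferInstance
  set Z : Ω → ℝ × (ℝ≥0 → ℝ) × 𝒥 := fun ω => (Q₀ ω, (fun t => X t ω), J ω)
  have hZm : Measurable Z := hQ.prodMk ((measurable_pi_lambda _ hX).prodMk hJ)
  let m : MeasurableSpace Ω := MeasurableSpace.comap Z inferInstance
  have hm : m ≤ mΩ := hZm.comap_le
  have hZc : Measurable[m] Z := comap_measurable Z
  have hQm : Measurable[m] Q₀ := measurable_fst.comp hZc
  have hXm : ∀ t, Measurable[m] (X t) := fun t =>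
    (measurable_pi_apply t).comp (measurable_fst.comp (measurable_snd.comp hZc))
  have hJm : Measurable[m] J := measurable_snd.comp (measurable_snd.comp hZc)
  have hid : @Measurable Ω Ω mΩ m id := measurable_id'' hm
  have hind' : @IndepFun Ω ℝ≥0 Ω mΩ _ m T id μ := by
    rw [IndepFun_iff_Indep] at hind ⊢
    rwa [MeasurableSpace.comap_id]
  have hprod := @map_prodMk_cond_eq_prod Ω Ω ℝ≥0 mΩ m _ μ _ T hT id hid hind' (J ⁻¹' B) (hJm hB)
  exact @identDistrib_comp_of_map_prodMk Ω Ω ℝ≥0 _ mΩ m _ _ (cond μ (J ⁻¹' B)) hν _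
    hP T hT id hid hprod (workloadData Q₀ X) (@measurable_workloadData Ω m Q₀ X hQm hXm hc)

/-- Independence of the initial workload and the input process carries over to the state of the
input process at an independent time. -/
lemma indepFun_input_at_time (hQ : Measurable Q₀) (hX : ∀ t, Measurable (X t))
    (hc : ∀ ω, IsCadlag fun t => X t ω) {ν : Measure Ω} [IsFiniteMeasure ν] {P : Measure ℝ≥0}
    [IsProbabilityMeasure P]
    (hid : IdentDistrib (fun ω => workloadData Q₀ X (T ω, ω)) (workloadData Q₀ X) ν (P.prod ν))
    (hind : IndepFun Q₀ (fun ω => ((fun t => X t ω), J ω)) ν) :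
    IndepFun Q₀ (fun ω => (X (T ω) ω, depth (fun t => X t ω) (T ω))) ν := by
  have hfix : ∀ t, IndepFun Q₀ (fun ω => (X t ω, depth (fun t => X t ω) t)) ν := by
    intro t
    rw [IndepFun_iff_Indep] at hind ⊢
    refine indep_of_indep_of_le_right hind ?_
    set Z : Ω → (ℝ≥0 → ℝ) × 𝒥 := fun ω => ((fun t => X t ω), J ω)
    let m : MeasurableSpace Ω := MeasurableSpace.comap Z inferInstance
    have hXm : ∀ t, Measurable[m] (X t) := fun t =>
      (measurable_pi_apply t).comp (measurable_fst.comp (comap_measurable Z))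
    exact (@measurable_input Ω m X hXm hc t).comap_le
  have hdata := measurable_workloadData hQ hX hc
  rw [indepFun_iff_measure_inter_preimage_eq_mul]
  intro a b ha hb
  have e : ∀ s : Set (ℝ × ℝ × ℝ), MeasurableSet s →
      ν {ω | workloadData Q₀ X (T ω, ω) ∈ s} =
        ∫⁻ t, ν {ω | workloadData Q₀ X (t, ω) ∈ s} ∂P := fun s hs => by
    have := hid.measure_mem_eq hs
    rw [Measure.prod_apply (hdata hs)] at this
    exact this
  have e1 := e (a ×ˢ b) (ha.prod hb)
  have e2 := e (univ ×ˢ b) (MeasurableSet.univ.prod hb)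
  simp only [workloadData, mem_prod, mem_univ, true_and] at e1 e2
  calc ν (Q₀ ⁻¹' a ∩ (fun ω => (X (T ω) ω, depth (fun t => X t ω) (T ω))) ⁻¹' b)
      = ∫⁻ t, ν {ω | Q₀ ω ∈ a ∧ (X t ω, depth (fun t => X t ω) t) ∈ b} ∂P := e1
    _ = ∫⁻ t, ν (Q₀ ⁻¹' a) * ν {ω | (X t ω, depth (fun t => X t ω) t) ∈ b} ∂P := by
        congr 1 with t
        exact (hfix t).measure_inter_preimage_eq_mul a b ha hb
    _ = ν (Q₀ ⁻¹' a) * ν {ω | (X (T ω) ω, depth (fun t => X t ω) (T ω)) ∈ b} := by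
        rw [e2, lintegral_const_mul']
        exact measure_ne_top _ _

/-- The workload at an independent time has the stationary law. -/
lemma identDistrib_workload_at_time (hQ : Measurable Q₀) (hX : ∀ t, Measurable (X t))
    (hc : ∀ ω, IsCadlag fun t => X t ω) {P : Measure ℝ≥0} [IsProbabilityMeasure P]
    (hstat : ∀ t, IdentDistrib (workload Q₀ X t) Q₀ μ μ) :
    IdentDistrib (fun p : ℝ≥0 × Ω => workload Q₀ X p.1 p.2) Q₀ (P.prod μ) μ := by
  have hG : Measurable fun p : ℝ × ℝ × ℝ => p.2.1 + max p.1 p.2.2 := by fun_prop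
  have hm : Measurable fun p : ℝ≥0 × Ω => workload Q₀ X p.1 p.2 :=
    hG.comp (measurable_workloadData hQ hX hc)
  refine ⟨hm.aemeasurable, hQ.aemeasurable, ?_⟩
  ext s hs
  rw [Measure.map_apply hm hs, Measure.map_apply hQ hs, Measure.prod_apply (hm hs)]
  have : ∀ t, μ (Prod.mk t ⁻¹' ((fun p : ℝ≥0 × Ω => workload Q₀ X p.1 p.2) ⁻¹' s)) =
      μ (Q₀ ⁻¹' s) := fun t => (hstat t).measure_mem_eq hs
  simp [this]

end RandomTime

/-! ### Exponential times and the discounted first passage time -/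

section Exponential

variable {Ω : Type*} [MeasurableSpace Ω] {μ : Measure Ω} {T : Ω → ℝ≥0} {θ : ℝ}

lemma discount_nonneg (θ : ℝ) (τ : ℝ≥0∞) : 0 ≤ discount θ τ := by
  unfold discount
  split_ifs
  · exact le_rfl
  · exact (Real.exp_pos _).le

/-- The discount factor is the probability that an exponential time is not exceeded. -/
lemma map_real_setOf_le [IsProbabilityMeasure μ] (hθ : 0 < θ) (hT : Measurable T)
    (hlaw : μ.map (fun ω => (T ω : ℝ)) = expMeasure θ) (τ : ℝ≥0∞) :
    (μ.map T).real {t | τ ≤ t} = discount θ τ := by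
  have := isProbabilityMeasure_expMeasure hθ
  rcases eq_or_ne τ ⊤ with rfl | hτ
  · simp [discount]
  · lift τ to ℝ≥0 using hτ
    have h1 : {t : ℝ≥0 | (τ : ℝ≥0∞) ≤ t} = NNReal.toReal ⁻¹' Ici (τ : ℝ) := by
      ext t; simp
    have h2 : (μ.map T).map NNReal.toReal = expMeasure θ := by
      rw [← hlaw, Measure.map_map measurable_coe_nnreal_real hT]; rfl
    have : NullSingletonClass (expMeasure θ) :=
      inferInstanceAs (NullSingletonClass (volume.withDensity (gammaPDF 1 θ)))
    have h0 : (0 : ℝ) ≤ τ := τ.2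
    rw [h1, ← map_measureReal_apply measurable_coe_nnreal_real measurableSet_Ici, h2,
      measureReal_congr Ioi_ae_eq_Ici.symm, ← compl_Iic, probReal_compl_eq_one_sub measurableSet_Iic,
      ← cdf_eq_real, cdf_expMeasure_eq hθ, if_pos h0]
    simp [discount]

variable {X : ℝ≥0 → Ω → ℝ}

/-- Up to the null event that the depth at the exponential time equals `y`, the event that the
first passage time of `-y` precedes this time is the event that the depth exceeds `y`. The first
passage time itself need not be measurable, so its discount factor is squeezed between measurable
functions. -/
lemma integral_discount_firstPassage {P : Measure ℝ≥0} [IsProbabilityMeasure P]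
    (hP : ∀ τ : ℝ≥0∞, P.real {t | τ ≤ t} = discount θ τ)
    (hX : ∀ t, Measurable (X t)) (hc : ∀ ω, IsCadlag fun t => X t ω) {ν : Measure Ω}
    [IsFiniteMeasure ν]
    (hid : IdentDistrib (fun ω => depth (fun t => X t ω) (T ω))
      (fun p : ℝ≥0 × Ω => depth (fun t => X t p.2) p.1) ν (P.prod ν)) (y : ℝ) :
    ∫ ω, discount θ (firstPassage (fun t => X t ω) y) ∂ν ≤
        ν.real {ω | y ≤ depth (fun t => X t ω) (T ω)} ∧
      (ν {ω | depth (fun t => X t ω) (T ω) = y} = 0 →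
        ∫ ω, discount θ (firstPassage (fun t => X t ω) y) ∂ν =
          ν.real {ω | y < depth (fun t => X t ω) (T ω)}) := by
  have hd := measurable_uncurry_depth hX hc
  have key : ∀ s : Set ℝ, MeasurableSet s →
      Integrable (fun ω => P.real {t | depth (fun t => X t ω) t ∈ s}) ν ∧
      ∫ ω, P.real {t | depth (fun t => X t ω) t ∈ s} ∂ν =
        ν.real {ω | depth (fun t => X t ω) (T ω) ∈ s} := by
    intro s hs
    have hm : Measurable fun ω => P {t | depth (fun t => X t ω) t ∈ s} :=
      measurable_measure_prodMk_right (hd hs)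
    constructor
    · exact Integrable.of_bound hm.ennreal_toReal.aestronglyMeasurable 1
        (ae_of_all _ fun ω => by rw [Real.norm_of_nonneg measureReal_nonneg]; exact measureReal_le_one)
    · have := hid.measure_mem_eq hs
      rw [Measure.prod_apply_symm (hd hs)] at this
      rw [measureReal_def]
      change _ = (ν ((fun ω => depth (fun t => X t ω) (T ω)) ⁻¹' s)).toReal
      rw [this]
      exact integral_toReal hm.aemeasurable (ae_of_all _ fun ω => measure_lt_top _ _)
  have hup : ∀ ω, discount θ (firstPassage (fun t => X t ω) y) ≤
      P.real {t | depth (fun t => X t ω) t ∈ Ici y} := fun ω => by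
    rw [← hP]
    exact measureReal_mono fun t ht => le_depth_of_firstPassage_le (hc ω) ht
  have hlow : ∀ ω, P.real {t | depth (fun t => X t ω) t ∈ Ioi y} ≤
      discount θ (firstPassage (fun t => X t ω) y) := fun ω => by
    rw [← hP]
    exact measureReal_mono fun t ht => firstPassage_le_of_lt_depth (hc ω) ht
  obtain ⟨i1, e1⟩ := key (Ici y) measurableSet_Ici
  obtain ⟨i2, e2⟩ := key (Ioi y) measurableSet_Ioi
  refine ⟨(integral_mono_of_nonneg (ae_of_all _ fun _ => discount_nonneg _ _) i1
    (ae_of_all _ hup)).trans_eq e1, fun hy => ?_⟩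
  have hreal : ν.real {ω | depth (fun t => X t ω) (T ω) ∈ Ici y} =
      ν.real {ω | depth (fun t => X t ω) (T ω) ∈ Ioi y} := by
    refine measureReal_congr ?_
    have : ∀ᵐ ω ∂ν, depth (fun t => X t ω) (T ω) ≠ y := by
      rw [ae_iff]; simpa using hy
    filter_upwards [this] with ω hω
    exact propext ⟨fun h => lt_of_le_of_ne (mem_Ici.1 h) hω.symm,
      fun h => (mem_Ioi.1 h).le⟩
  have hae : (fun ω => P.real {t | depth (fun t => X t ω) t ∈ Ioi y}) =ᵐ[ν]
      fun ω => P.real {t | depth (fun t => X t ω) t ∈ Ici y} := by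
    have hle : ∀ ω, P.real {t | depth (fun t => X t ω) t ∈ Ioi y} ≤
        P.real {t | depth (fun t => X t ω) t ∈ Ici y} := fun ω => (hlow ω).trans (hup ω)
    refine (integral_eq_iff_of_ae_le i2 i1 (ae_of_all _ hle)).1 ?_
    rw [e1, e2, hreal]
  refine Eq.trans (integral_congr_ae ?_) e2
  filter_upwards [hae] with ω hω
  exact le_antisymm ((hup ω).trans_eq hω.symm) (hlow ω)

end Exponential

/-- Expectations at an exponential time are normalized Laplace transforms in time. -/
lemma integral_exp_mul_eq_of_law {Ω : Type*} [MeasurableSpace Ω] {μ : Measure Ω} {T : Ω → ℝ≥0}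
    {θ : ℝ} (hθ : 0 < θ) (hT : Measurable T)
    (hlaw : μ.map (fun ω => (T ω : ℝ)) = expMeasure θ) {g : ℝ≥0 → ℝ}
    (hg : Integrable g (μ.map T)) :
    IntegrableOn (fun t : ℝ => Real.exp (-θ * t) * g t.toNNReal) (Ioi 0) ∧
      ∫ t in Ioi (0 : ℝ), Real.exp (-θ * t) * g t.toNNReal = θ⁻¹ * ∫ t, g t ∂(μ.map T) := by
  have hmap : μ.map T = (expMeasure θ).map Real.toNNReal := by
    rw [← hlaw, Measure.map_map measurable_real_toNNReal hT.coe_nnreal_real]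
    congr 1 with ω
    simp
  rw [hmap] at hg ⊢
  have hg' := hg.comp_measurable measurable_real_toNNReal
  rw [integral_map measurable_real_toNNReal.aemeasurable hg.aestronglyMeasurable]
  have hm : Measurable (gammaPDF 1 θ) := (measurable_gammaPDFReal 1 θ).ennreal_ofReal
  have hfin : ∀ᵐ x : ℝ, gammaPDF 1 θ x < ∞ := ae_of_all _ fun x => ENNReal.ofReal_lt_top
  have hdens : ∀ x : ℝ, (gammaPDF 1 θ x).toReal • g x.toNNReal =
      (Ici (0 : ℝ)).indicator (fun x => θ * (Real.exp (-θ * x) * g x.toNNReal)) x := by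
    intro x
    have : gammaPDF 1 θ x = exponentialPDF θ x := rfl
    rw [this, exponentialPDF_eq]
    by_cases hx : 0 ≤ x
    · rw [if_pos hx, indicator_of_mem (mem_Ici.2 hx), ENNReal.toReal_ofReal (by positivity),
        smul_eq_mul, neg_mul, mul_assoc]
    · rw [if_neg hx, indicator_of_notMem (by simpa using hx)]
      simp
  unfold expMeasure gammaMeasure at hg' ⊢
  rw [integral_withDensity_eq_integral_toReal_smul hm hfin]
  rw [integrable_withDensity_iff_integrable_smul' hm hfin] at hg'
  simp only [Function.comp_apply, hdens] at hg' ⊢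
  rw [integrable_indicator_iff measurableSet_Ici, integrableOn_Ici_iff_integrableOn_Ioi] at hg'
  rw [integral_indicator measurableSet_Ici, integral_Ici_eq_integral_Ioi, integral_const_mul,
    inv_mul_cancel_left₀ hθ.ne']
  refine ⟨?_, rfl⟩
  rw [IntegrableOn] at hg' ⊢
  simpa only [inv_mul_cancel_left₀ hθ.ne'] using hg'.const_mul θ⁻¹

/-! ### Expected excess over a level -/

/-- A random variable whose tail is a sum of decaying exponentials is integrable, and integrating
the tail gives its expected excess over a level. -/
lemma integral_excess_of_tail {Ω ι : Type*} [MeasurableSpace Ω] {ν : Measure Ω}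
    [IsFiniteMeasure ν] {W : Ω → ℝ} (hW : Measurable W) (hW0 : ∀ ω, 0 ≤ W ω) {s : Finset ι}
    {c ψ : ι → ℂ} (hψ : ∀ j ∈ s, 0 < (ψ j).re) {C : Set ℝ} (hC : C.Countable)
    (htail : ∀ y, 0 < y → y ∉ C →
      (ν.real {ω | y < W ω} : ℂ) = ∑ j ∈ s, c j * Complex.exp (-ψ j * y)) :
    Integrable W ν ∧ ∀ q : ℝ, 0 ≤ q → ((∫ ω, max (W ω - q) 0 ∂ν : ℝ) : ℂ) =
      ∑ j ∈ s, c j / ψ j * Complex.exp (-ψ j * q) := by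
  have hexp : ∀ j ∈ s, IntegrableOn (fun y : ℝ => Complex.exp (-ψ j * y)) (Ioi 0) := fun j hj =>
    integrableOn_exp_mul_complex_Ioi (by simpa using hψ j hj) 0
  have hint : Integrable W ν := by
    refine ⟨hW.aestronglyMeasurable, ?_⟩
    rw [hasFiniteIntegral_iff_ofReal (ae_of_all _ hW0),
      lintegral_eq_lintegral_meas_lt ν (ae_of_all _ hW0) hW.aemeasurable]
    have hf : IntegrableOn (fun y : ℝ => ∑ j ∈ s, c j * Complex.exp (-ψ j * y)) (Ioi 0) :=
      integrable_finsetSum _ fun j hj => (hexp j hj).const_mul _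
    refine lt_of_le_of_lt (lintegral_mono_ae ?_) hf.2
    filter_upwards [ae_restrict_mem measurableSet_Ioi, ae_restrict_of_ae (hC.ae_notMem volume)]
      with y hy hyC
    rw [← htail y hy hyC, ← ofReal_measureReal, ← Real.enorm_of_nonneg measureReal_nonneg,
      enorm_eq_nnnorm, enorm_eq_nnnorm, Complex.nnnorm_real]
  refine ⟨hint, fun q hq => ?_⟩
  have hpos : Integrable (fun ω => max (W ω - q) 0) ν :=
    (hint.sub (integrable_const q)).pos_part
  rw [hpos.integral_eq_integral_meas_lt (ae_of_all _ fun ω => le_max_right _ _), ← integral_complex_ofReal]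
  have hCq : ((fun t : ℝ => q + t) ⁻¹' C).Countable := hC.preimage (add_right_injective q)
  have hcongr : ∫ t in Ioi (0 : ℝ), (ν.real {ω | t < max (W ω - q) 0} : ℂ) =
      ∫ t in Ioi (0 : ℝ), ∑ j ∈ s, c j * Complex.exp (-ψ j * q) * Complex.exp (-ψ j * t) := by
    refine integral_congr_ae ?_
    filter_upwards [ae_restrict_mem measurableSet_Ioi, ae_restrict_of_ae (hCq.ae_notMem volume)]
      with t ht htC
    have ht' : 0 < t := ht
    have e : {ω | t < max (W ω - q) 0} = {ω | q + t < W ω} := by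
      ext ω
      simp only [lt_sup_iff, mem_ofPred_eq]
      constructor
      · rintro (h | h) <;> linarith
      · intro h; left; linarith
    rw [e, htail (q + t) (by linarith) htC]
    refine Finset.sum_congr rfl fun j _ => ?_
    rw [mul_assoc, ← Complex.exp_add]
    congr 2
    push_cast
    ring
  rw [hcongr, integral_finsetSum _ fun j hj => (hexp j hj).const_mul _]
  refine Finset.sum_congr rfl fun j hj => ?_
  have hne : ψ j ≠ 0 := fun h => by simpa [h] using hψ j hj
  rw [integral_const_mul, integral_exp_mul_complex_Ioi (by simpa using hψ j hj)]
  simp only [Complex.ofReal_zero, mul_zero, Complex.exp_zero]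
  field_simp

/-- The mixed moment of `Q` and `V + max Q W`, for an independent pair `(V, W)`: the excess of `W`
over `Q` is integrated out conditionally on `Q`. -/
lemma integral_mul_workload {Ω ι : Type*} [MeasurableSpace Ω] {ν : Measure Ω}
    [IsFiniteMeasure ν] {Q V W : Ω → ℝ} (hQ : Measurable Q) (hQ0 : ∀ᵐ ω ∂ν, 0 ≤ Q ω)
    (hQ2 : MemLp Q 2 ν) (hV : Integrable V ν) (hW : Measurable W) (hW0 : ∀ ω, 0 ≤ W ω)
    (hWi : Integrable W ν) (hind : IndepFun Q (fun ω => (V ω, W ω)) ν) {s : Finset ι}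
    {c ψ : ι → ℂ} (hψ : ∀ j ∈ s, 0 < (ψ j).re)
    (hexc : ∀ q : ℝ, 0 ≤ q → ((∫ ω, max (W ω - q) 0 ∂ν : ℝ) : ℂ) =
      ∑ j ∈ s, c j / ψ j * Complex.exp (-ψ j * q)) :
    ((∫ ω, Q ω * (V ω + max (Q ω) (W ω)) ∂ν : ℝ) : ℂ) =
      ((∫ ω, Q ω ∂ν : ℝ) : ℂ) * ((∫ ω, V ω ∂ν : ℝ) : ℂ) + ((∫ ω, Q ω ^ 2 ∂ν : ℝ) : ℂ) +
        ∑ j ∈ s, c j / ψ j * ∫ ω, (Q ω : ℂ) * Complex.exp (-ψ j * Q ω) ∂ν := by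
  have hQi : Integrable Q ν := hQ2.integrable one_le_two
  have hQV : IndepFun Q V ν := hind.comp measurable_id measurable_fst
  have hQW : IndepFun Q W ν := hind.comp measurable_id measurable_snd
  have iQV : Integrable (fun ω => Q ω * V ω) ν := hQV.integrable_mul hQi hV
  have iQW : Integrable (fun ω => Q ω * W ω) ν := hQW.integrable_mul hQi hWi
  have hF : Measurable fun p : ℝ × ℝ => p.1 * max (p.2 - p.1) 0 := by fun_prop
  have iE : Integrable (fun ω => Q ω * max (W ω - Q ω) 0) ν := by
    refine iQW.mono' (hF.comp (hQ.prodMk hW)).aestronglyMeasurable ?_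
    filter_upwards [hQ0] with ω hω
    rw [Real.norm_of_nonneg (mul_nonneg hω (le_max_right _ _))]
    exact mul_le_mul_of_nonneg_left (max_le (by linarith) (hW0 ω)) hω
  have hE : ((∫ ω, Q ω * max (W ω - Q ω) 0 ∂ν : ℝ) : ℂ) =
      ∑ j ∈ s, c j / ψ j * ∫ ω, (Q ω : ℂ) * Complex.exp (-ψ j * Q ω) ∂ν := by
    have hmap := hQW.map_prod_eq_prod_map_map hQ.aemeasurable hW.aemeasurable
    have i1 : Integrable (fun p : ℝ × ℝ => p.1 * max (p.2 - p.1) 0)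
        ((ν.map Q).prod (ν.map W)) := by
      rw [← hmap, integrable_map_measure hF.aestronglyMeasurable (hQ.prodMk hW).aemeasurable]
      exact iE
    have e1 : ∫ ω, Q ω * max (W ω - Q ω) 0 ∂ν =
        ∫ q, ∫ w, q * max (w - q) 0 ∂(ν.map W) ∂(ν.map Q) := by
      rw [← integral_prod _ i1, ← hmap,
        integral_map (hQ.prodMk hW).aemeasurable hF.aestronglyMeasurable]
    have e2 : ∀ q : ℝ, ∫ w, q * max (w - q) 0 ∂(ν.map W) = q * ∫ ω, max (W ω - q) 0 ∂ν := by
      intro q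
      rw [integral_const_mul, integral_map hW.aemeasurable]
      exact Continuous.aestronglyMeasurable (by fun_prop)
    have hG : StronglyMeasurable fun q : ℝ => ∫ w, q * max (w - q) 0 ∂(ν.map W) :=
      hF.stronglyMeasurable.integral_prod_right
    rw [e1, integral_map hQ.aemeasurable hG.aestronglyMeasurable, ← integral_complex_ofReal]
    have hae : ∀ᵐ ω ∂ν, ((∫ w, Q ω * max (w - Q ω) 0 ∂(ν.map W) : ℝ) : ℂ) =
        ∑ j ∈ s, c j / ψ j * ((Q ω : ℂ) * Complex.exp (-ψ j * Q ω)) := by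
      filter_upwards [hQ0] with ω hω
      rw [e2, Complex.ofReal_mul, hexc _ hω, Finset.mul_sum]
      exact Finset.sum_congr rfl fun j _ => by ring
    rw [integral_congr_ae hae, integral_finsetSum]
    · exact Finset.sum_congr rfl fun j _ => integral_const_mul _ _
    · intro j hj
      refine Integrable.const_mul ?_ _
      refine hQi.ofReal.mul_bdd (c := 1) (Measurable.aestronglyMeasurable (by fun_prop)) ?_
      filter_upwards [hQ0] with ω hω using norm_exp_mul_le_one (hψ j hj).le hω
  have hsplit : ∀ ω, Q ω * (V ω + max (Q ω) (W ω)) =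
      Q ω * V ω + Q ω ^ 2 + Q ω * max (W ω - Q ω) 0 := fun ω => by
    rcases le_total (Q ω) (W ω) with h | h
    · rw [max_eq_right h, max_eq_left (sub_nonneg.2 h)]; ring
    · rw [max_eq_left h, max_eq_right (sub_nonpos.2 h)]; ring
  have iS : Integrable (fun ω => Q ω * V ω + Q ω ^ 2) ν := iQV.add hQ2.integrable_sq
  rw [integral_congr_ae (ae_of_all _ hsplit), integral_add iS iE,
    integral_add iQV hQ2.integrable_sq,
    hQV.integral_fun_mul_eq_mul_integral hQi.aestronglyMeasurable hV.aestronglyMeasurable,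
    ← hE]
  push_cast
  ring

/-! ### Conditioning on the initial background state -/

lemma setIntegral_eq_mul_integral_cond {Ω E : Type*} [MeasurableSpace Ω] [NormedAddCommGroup E]
    [NormedSpace ℝ E] {μ : Measure Ω} [IsFiniteMeasure μ] (s : Set Ω) (f : Ω → E) :
    ∫ ω in s, f ω ∂μ = μ.real s • ∫ ω, f ω ∂(cond μ s) := by
  rcases eq_or_ne (μ s) 0 with h | h
  · simp [Measure.restrict_eq_zero.2 h, measureReal_def, h]
  · rw [ProbabilityTheory.cond, integral_smul_measure, smul_smul, ENNReal.toReal_inv, measureReal_def,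
      mul_inv_cancel₀ (ENNReal.toReal_ne_zero.2 ⟨h, measure_ne_top _ _⟩), one_smul]

lemma memLp_cond {Ω : Type*} [MeasurableSpace Ω] {μ : Measure Ω} {f : Ω → ℝ}
    {p : ℝ≥0∞} (hf : MemLp f p μ) (s : Set Ω) : MemLp f p (cond μ s) := by
  rcases eq_or_ne (μ s) 0 with h | h
  · simp [ProbabilityTheory.cond, Measure.restrict_eq_zero.2 h]
  · exact (hf.restrict s).smul_measure (ENNReal.inv_ne_top.2 h)

lemma integral_eq_sum_setIntegral_fiber {Ω ι E : Type*} [MeasurableSpace Ω] [Fintype ι]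
    [MeasurableSpace ι] [MeasurableSingletonClass ι] [NormedAddCommGroup E] [NormedSpace ℝ E]
    {μ : Measure Ω} {J : Ω → ι} (hJ : Measurable J) {f : Ω → E} (hf : Integrable f μ) :
    ∫ ω, f ω ∂μ = ∑ i, ∫ ω in J ⁻¹' {i}, f ω ∂μ := by
  rw [← integral_iUnion_fintype (fun i => hJ (measurableSet_singleton i)) ?_
    fun i => hf.integrableOn, ← preimage_iUnion, iUnion_of_singleton, preimage_univ, setIntegral_univ]
  intro i j hij
  exact (disjoint_singleton.2 hij).preimage J

/-! ### The queue, conditionally on its initial background state -/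

section Queue

variable {Ω : Type*} [MeasurableSpace Ω] {μ : Measure Ω} [IsProbabilityMeasure μ] {d : ℕ}
  {J : ℝ≥0 → Ω → Fin d} {X : ℝ≥0 → Ω → ℝ} {Q₀ : Ω → ℝ} {T : Ω → ℝ≥0} {θ : ℝ}

lemma measurable_comp_time {f : ℝ≥0 × Ω → ℝ} (hf : Measurable f) (hT : Measurable T) :
    Measurable fun ω => f (T ω, ω) :=
  hf.comp (hT.prodMk measurable_id)

/-- The tail of the depth at an exponential time is the given exponential sum, in which only the
decaying terms survive. So the depth has a finite mean and an explicit expected excess. -/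
lemma integral_depth_excess (hX : ∀ t, Measurable (X t)) (hX0 : ∀ ω, X 0 ω = 0)
    (hc : ∀ ω, IsCadlag fun t => X t ω) (hθ : 0 < θ) (hT : Measurable T)
    (hlaw : μ.map (fun ω => (T ω : ℝ)) = expMeasure θ) {ν : Measure Ω} [IsFiniteMeasure ν]
    (hid : IdentDistrib (fun ω => depth (fun t => X t ω) (T ω))
      (fun p : ℝ≥0 × Ω => depth (fun t => X t p.2) p.1) ν ((μ.map T).prod ν))
    {ι : Type*} [Fintype ι] {c ψ : ι → ℂ}
    (hexp : ∀ y : ℝ, 0 < y →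
      ((∫ ω, discount θ (firstPassage (fun t => X t ω) y) ∂ν : ℝ) : ℂ) =
        ∑ j, c j * Complex.exp (-ψ j * y)) :
    (∀ g : ℂ → ℂ, ∑ j, c j * g (ψ j) = ∑ j with 0 < (ψ j).re, c j * g (ψ j)) ∧
    Integrable (fun ω => depth (fun t => X t ω) (T ω)) ν ∧
      ∀ q : ℝ, 0 ≤ q → ((∫ ω, max (depth (fun t => X t ω) (T ω) - q) 0 ∂ν : ℝ) : ℂ) =
        ∑ j with 0 < (ψ j).re, c j / ψ j * Complex.exp (-ψ j * q) := by
  have : IsProbabilityMeasure (μ.map T) := Measure.isProbabilityMeasure_map hT.aemeasurable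
  set W : Ω → ℝ := fun ω => depth (fun t => X t ω) (T ω)
  have hW : Measurable W := measurable_comp_time (measurable_uncurry_depth hX hc) hT
  have hsq := fun y : ℝ => integral_discount_firstPassage (T := T)
    (map_real_setOf_le hθ hT hlaw) hX hc hid y
  have htail0 : Tendsto (fun y : ℝ => ν.real {ω | y ≤ W ω}) atTop (𝓝 0) := by
    have h := tendsto_measure_iInter_atTop (μ := ν) (s := fun y : ℝ => {ω | y ≤ W ω})
      (fun y => (measurableSet_le measurable_const hW).nullMeasurableSet)
      (fun a b hab ω (hω : b ≤ W ω) => hab.trans hω) ⟨0, measure_ne_top _ _⟩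
    have hempty : ⋂ y : ℝ, {ω | y ≤ W ω} = ∅ := by
      refine eq_empty_of_forall_notMem fun ω hω => ?_
      have : W ω + 1 ≤ W ω := mem_iInter.1 hω (W ω + 1)
      linarith
    rw [hempty, measure_empty] at h
    exact (ENNReal.tendsto_toReal ENNReal.zero_ne_top).comp h
  have hlim : Tendsto (fun y : ℝ => ∑ j, c j * Complex.exp (-ψ j * y)) atTop (𝓝 0) := by
    have h1 : Tendsto (fun y : ℝ => ∫ ω, discount θ (firstPassage (fun t => X t ω) y) ∂ν)
        atTop (𝓝 0) :=
      squeeze_zero (fun y => integral_nonneg fun _ => discount_nonneg _ _)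
        (fun y => (hsq y).1) htail0
    have h2 := (Complex.continuous_ofReal.tendsto 0).comp h1
    rw [Complex.ofReal_zero] at h2
    refine h2.congr' ?_
    filter_upwards [eventually_gt_atTop 0] with y hy using hexp y hy
  have hfilter := sum_mul_eq_sum_filter_re_pos hlim
  refine ⟨hfilter, ?_⟩
  refine integral_excess_of_tail hW (fun ω => depth_nonneg (hc ω) (hX0 ω) _)
    (s := {j | 0 < (ψ j).re}) (fun j hj => (Finset.mem_filter.1 hj).2)
    (C := {y | 0 < ν {ω | W ω = y}}) (Measure.countable_meas_level_set_pos hW) fun y hy hyC => ?_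
  rw [← (hsq y).2 (le_antisymm (not_lt.1 hyC) bot_le), hexp y hy,
    hfilter fun z => Complex.exp (-z * y)]

/-- The covariance formula before summation over the initial background states. -/
lemma setIntegral_mul_workload (hX : ∀ t, Measurable (X t)) (hX0 : ∀ ω, X 0 ω = 0)
    (hc : ∀ ω, IsCadlag fun t => X t ω) (hJ : ∀ t, Measurable (J t))
    (hQ : IsStationaryWorkload Q₀ J X μ) (hQ2 : MemLp Q₀ 2 μ) (hθ : 0 < θ)
    (hT : IsIndepExponential θ T Q₀ J X μ)
    (hQT : Integrable (fun ω => workload Q₀ X (T ω) ω) μ) {c ψ : Fin d → ℂ} (i : Fin d)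
    (hexp : ∀ y : ℝ, 0 < y → (xi J X μ θ i y : ℂ) = ∑ j, c j * Complex.exp (-ψ j * y)) :
    Integrable (fun ω => X (T ω) ω) (cond μ (J 0 ⁻¹' {i})) ∧
      ((∫ ω in J 0 ⁻¹' {i}, Q₀ ω * workload Q₀ X (T ω) ω ∂μ : ℝ) : ℂ) =
        ((∫ ω in J 0 ⁻¹' {i}, Q₀ ω ^ 2 ∂μ : ℝ) : ℂ)
          - ∑ j, c j / ψ j * hpDeriv (kappaState Q₀ J μ i) (ψ j)
          - (nu J X T μ i : ℂ) * hpDeriv (kappaState Q₀ J μ i) 0 := by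
  set ν := cond μ (J 0 ⁻¹' {i})
  have hQm := hQ.measurable
  have hTm := hT.measurable
  have : IsProbabilityMeasure (μ.map T) := Measure.isProbabilityMeasure_map hTm.aemeasurable
  have hdata : IdentDistrib (fun ω => workloadData Q₀ X (T ω, ω)) (workloadData Q₀ X) ν
      ((μ.map T).prod ν) :=
    identDistrib_workloadData hQm hX hc (measurable_pi_lambda _ hJ) hTm hT.indep
      (B := (fun j : ℝ≥0 → Fin d => j 0) ⁻¹' {i})
      (measurable_pi_apply (0 : ℝ≥0) (measurableSet_singleton i))
  obtain ⟨hfilter, hWi, hexc⟩ := integral_depth_excess hX hX0 hc hθ hTm hT.law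
    (hdata.comp (measurable_snd.comp measurable_snd)) hexp
  have hind := indepFun_input_at_time hQm hX hc hdata (hQ.cond_indep i)
  have hW0 : ∀ ω, 0 ≤ depth (fun t => X t ω) (T ω) := fun ω => depth_nonneg (hc ω) (hX0 ω) _
  have hXT : Measurable fun ω => X (T ω) ω :=
    measurable_comp_time (measurable_uncurry_of_cadlag hX hc) hTm
  have hV : Integrable (fun ω => X (T ω) ω) ν := by
    have hQTν : Integrable (fun ω => workload Q₀ X (T ω) ω) ν :=
      memLp_one_iff_integrable.1 (memLp_cond (memLp_one_iff_integrable.2 hQT) _)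
    refine (hQTν.norm.add hWi).mono' hXT.aestronglyMeasurable (ae_of_all _ fun ω => ?_)
    have h1 := le_max_right (Q₀ ω) (depth (fun t => X t ω) (T ω))
    have h2 := neg_le_depth (hc ω) (le_refl (T ω))
    have h3 := le_abs_self (workload Q₀ X (T ω) ω)
    have h4 := workload_eq Q₀ X (T ω) ω
    have h5 := hW0 ω
    simp only [Pi.add_apply, Real.norm_eq_abs]
    -- the input is at least minus its depth, and at most the workload
    exact abs_le.2 ⟨by linarith [abs_nonneg (workload Q₀ X (T ω) ω)], by linarith⟩
  refine ⟨hV, ?_⟩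
  have hQ0ν : ∀ᵐ ω ∂ν, 0 ≤ Q₀ ω := cond_absolutelyContinuous.ae_le hQ.nonneg
  have key := integral_mul_workload hQm hQ0ν (memLp_cond hQ2 _) hV
    (measurable_comp_time (measurable_uncurry_depth hX hc) hTm) hW0 hWi hind
    (fun j hj => (Finset.mem_filter.1 hj).2) hexc
  have hQi := hQ2.integrable one_le_two
  have hder : ∀ z : ℂ, 0 ≤ z.re → hpDeriv (kappaState Q₀ J μ i) z =
      -((μ.real (J 0 ⁻¹' {i}) : ℂ) * ∫ ω, (Q₀ ω : ℂ) * Complex.exp (-z * Q₀ ω) ∂ν) := by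
    intro z hz
    have h := hasDerivWithinAt_laplace (μ := μ.restrict (J 0 ⁻¹' {i})) (g := fun _ => 1) hQm
      (ae_restrict_of_ae hQ.nonneg) (integrable_const _) (by simpa using hQi.restrict) hz
    simp only [Complex.ofReal_one, one_mul] at h
    rw [hpDeriv, ← Complex.real_smul, ← setIntegral_eq_mul_integral_cond]
    exact h.derivWithin (uniqueDiffOn_re_nonneg z hz)
  have hsum : ∑ j, c j / ψ j * hpDeriv (kappaState Q₀ J μ i) (ψ j) =
      -((μ.real (J 0 ⁻¹' {i}) : ℂ) * ∑ j with 0 < (ψ j).re,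
        c j / ψ j * ∫ ω, (Q₀ ω : ℂ) * Complex.exp (-ψ j * Q₀ ω) ∂ν) := by
    -- the non-decaying terms cancel because the cofactor of `c j` depends on `ψ j` only; this covers
    -- `ψ j = 0` and exponents outside the half-plane, whatever values the cofactor has there
    have h := hfilter fun z => hpDeriv (kappaState Q₀ J μ i) z / z
    rw [Finset.mul_sum, ← Finset.sum_neg_distrib]
    calc _ = ∑ j, c j * (hpDeriv (kappaState Q₀ J μ i) (ψ j) / ψ j) :=
          Finset.sum_congr rfl fun j _ => by ring
      _ = _ := h
      _ = _ := Finset.sum_congr rfl fun j hj => by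
          rw [hder _ (Finset.mem_filter.1 hj).2.le]; ring
  have h0 := hder 0 le_rfl
  simp only [neg_zero, zero_mul, Complex.exp_zero, mul_one, integral_complex_ofReal] at h0
  rw [hsum, h0, setIntegral_eq_mul_integral_cond, setIntegral_eq_mul_integral_cond]
  simp only [workload_eq, smul_eq_mul, Complex.ofReal_mul]
  rw [key]
  simp only [nu]
  ring

/-! ### The correlation function -/

/-- The correlation coefficient, in stationarity, is an affine function of the mixed moment. -/
lemma corr_eq (hQ : IsStationaryWorkload Q₀ J X μ) (hQ2 : MemLp Q₀ 2 μ) (t : ℝ≥0) :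
    corr Q₀ X μ t = ((∫ ω, Q₀ ω * workload Q₀ X t ω ∂μ) - (∫ ω, Q₀ ω ∂μ) ^ 2) / variance Q₀ μ := by
  have hid : IdentDistrib (workload Q₀ X t) Q₀ μ μ := (hQ.stationary t).comp measurable_fst
  have hmem : MemLp (workload Q₀ X t) 2 μ := hid.symm.memLp_snd hQ2
  rw [corr, hid.variance_eq, Real.sqrt_mul_self (variance_nonneg _ _),
    covariance_eq_sub hQ2 hmem, hid.integral_eq, sq]
  rfl

end Queue

end SPMap

theorem theorem3 {Ω : Type*} [MeasurableSpace Ω] (μ : Measure Ω) [IsProbabilityMeasure μ] {d : ℕ}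
    (q : Matrix (Fin d) (Fin d) ℝ) (Y : Fin d → ℝ≥0 → Ω → ℝ) (U : Fin d → Fin d → ℕ → Ω → ℝ)
    (J : ℝ≥0 → Ω → Fin d) (X : ℝ≥0 → Ω → ℝ) (hX : SPMap.IsSPMap q Y U J X μ)
    (p : Fin d → ℝ) (hp : p ∈ stdSimplex ℝ (Fin d)) (hpq : p ᵥ* q = 0)
    (hstable : SPMap.IsStable q Y U p μ)
    (Q₀ : Ω → ℝ) (hQ : SPMap.IsStationaryWorkload Q₀ J X μ) (hQ2 : MemLp Q₀ 2 μ)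
    (θ : ℝ) (hθ : 0 < θ)
    (T : Ω → ℝ≥0) (hT : SPMap.IsIndepExponential θ T Q₀ J X μ)
    (c : Fin d → Fin d → ℂ) (ψ : Fin d → ℂ)
    (hexp : ∀ i, ∀ y : ℝ, 0 < y →
      (SPMap.xi J X μ θ i y : ℂ) = ∑ j, c i j * Complex.exp (-ψ j * y)) :
    (MemLp (fun ω => SPMap.workload Q₀ X (T ω) ω) 2 μ ∧
      ∀ i, Integrable (fun ω => X (T ω) ω) (cond μ (J 0 ⁻¹' {i}))) ∧
    (SPMap.gammaCov Q₀ X T μ : ℂ) =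
      SPMap.hpDeriv (SPMap.hpDeriv (SPMap.kappa Q₀ μ)) 0
        - (SPMap.hpDeriv (SPMap.kappa Q₀ μ) 0) ^ 2
        - ∑ i, ∑ j, c i j / ψ j * SPMap.hpDeriv (SPMap.kappaState Q₀ J μ i) (ψ j)
        - ∑ i, (SPMap.nu J X T μ i : ℂ) * SPMap.hpDeriv (SPMap.kappaState Q₀ J μ i) 0 ∧
    (variance Q₀ μ ≠ 0 →
      IntegrableOn (fun t : ℝ => Real.exp (-θ * t) * SPMap.corr Q₀ X μ t.toNNReal) (Ioi 0) ∧
      ∫ t in Ioi (0 : ℝ), Real.exp (-θ * t) * SPMap.corr Q₀ X μ t.toNNReal =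
        SPMap.gammaCov Q₀ X T μ / (θ * variance Q₀ μ)) := by
  have hc := hX.isCadlag
  have hJ := hX.chain.measurable
  have hQm := hQ.measurable
  have hTm := hT.measurable
  have hP : IsProbabilityMeasure (μ.map T) := Measure.isProbabilityMeasure_map hTm.aemeasurable
  have hQi := hQ2.integrable one_le_two
  have hdata : IdentDistrib (fun ω => SPMap.workloadData Q₀ X (T ω, ω)) (SPMap.workloadData Q₀ X) μ
      ((μ.map T).prod μ) := by
    have h := SPMap.identDistrib_workloadData hQm hX.measurable hc (measurable_pi_lambda _ hJ) hTm
      hT.indep MeasurableSet.univ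
    rwa [preimage_univ, cond_univ] at h
  have hG : Measurable fun p : ℝ × ℝ × ℝ => p.2.1 + max p.1 p.2.2 := by fun_prop
  have hQT : IdentDistrib (fun ω => SPMap.workload Q₀ X (T ω) ω) Q₀ μ μ :=
    (hdata.comp hG).trans (SPMap.identDistrib_workload_at_time hQm hX.measurable hc
      fun t => (hQ.stationary t).comp measurable_fst)
  have hmem : MemLp (fun ω => SPMap.workload Q₀ X (T ω) ω) 2 μ := hQT.symm.memLp_snd hQ2
  have hprod : Integrable (fun ω => Q₀ ω * SPMap.workload Q₀ X (T ω) ω) μ := hQ2.integrable_mul hmem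
  have hstate := fun i => SPMap.setIntegral_mul_workload hX.measurable hX.zero hc hJ hQ hQ2 hθ hT
    (hmem.integrable one_le_two) i (hexp i)
  have hgamma : SPMap.gammaCov Q₀ X T μ =
      (∫ ω, Q₀ ω * SPMap.workload Q₀ X (T ω) ω ∂μ) - (∫ ω, Q₀ ω ∂μ) ^ 2 := by
    rw [SPMap.gammaCov, covariance_eq_sub hQ2 hmem, hQT.integral_eq, sq]
    rfl
  refine ⟨⟨hmem, fun i => (hstate i).1⟩, ?_, fun hvar => ?_⟩
  · have hder : ∀ z : ℂ, 0 ≤ z.re → SPMap.hpDeriv (SPMap.kappa Q₀ μ) z =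
        -∫ ω, (Q₀ ω : ℂ) * Complex.exp (-z * Q₀ ω) ∂μ := fun z hz => by
      have h := SPMap.hasDerivWithinAt_laplace (g := fun _ => 1) hQm hQ.nonneg
        (integrable_const _) (by simpa using hQi) hz
      simp only [Complex.ofReal_one, one_mul] at h
      exact h.derivWithin (SPMap.uniqueDiffOn_re_nonneg z hz)
    have hd1 : SPMap.hpDeriv (SPMap.kappa Q₀ μ) 0 = -((∫ ω, Q₀ ω ∂μ : ℝ) : ℂ) := by
      have h := hder 0 le_rfl
      simpa only [neg_zero, zero_mul, Complex.exp_zero, mul_one, integral_complex_ofReal] using h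
    have hd2 : SPMap.hpDeriv (SPMap.hpDeriv (SPMap.kappa Q₀ μ)) 0 =
        ((∫ ω, Q₀ ω ^ 2 ∂μ : ℝ) : ℂ) := by
      have h := (SPMap.hasDerivWithinAt_laplace (z := 0) hQm hQ.nonneg hQi
        (by simpa only [sq] using hQ2.integrable_sq) le_rfl).neg
      have h' := (h.congr (fun z hz => hder z hz) (hder 0 le_rfl)).derivWithin
        (SPMap.uniqueDiffOn_re_nonneg 0 (by simp))
      change derivWithin (SPMap.hpDeriv (SPMap.kappa Q₀ μ)) {z : ℂ | 0 ≤ z.re} 0 = _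
      simpa only [neg_neg, neg_zero, zero_mul, Complex.exp_zero, mul_one, integral_complex_ofReal,
        ← sq] using h'
    rw [hgamma, hd1, hd2, SPMap.integral_eq_sum_setIntegral_fiber (hJ 0) hprod,
      SPMap.integral_eq_sum_setIntegral_fiber (hJ 0) hQ2.integrable_sq]
    push_cast
    rw [Finset.sum_congr rfl fun i _ => (hstate i).2]
    simp only [Finset.sum_sub_distrib]
    ring
  · have hH : Measurable fun p : ℝ × ℝ × ℝ => p.1 * (p.2.1 + max p.1 p.2.2) := by fun_prop
    have hid := hdata.comp hH
    have hint : Integrable (fun p : ℝ≥0 × Ω => Q₀ p.2 * SPMap.workload Q₀ X p.1 p.2)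
        ((μ.map T).prod μ) := hid.integrable_iff.1 hprod
    have hmix : ∫ ω, Q₀ ω * SPMap.workload Q₀ X (T ω) ω ∂μ =
        ∫ t, ∫ ω, Q₀ ω * SPMap.workload Q₀ X t ω ∂μ ∂(μ.map T) :=
      hid.integral_eq.trans (integral_prod _ hint)
    have hcorr : SPMap.corr Q₀ X μ = fun t => ((∫ ω, Q₀ ω * SPMap.workload Q₀ X t ω ∂μ) -
        (∫ ω, Q₀ ω ∂μ) ^ 2) / variance Q₀ μ := funext fun t => SPMap.corr_eq hQ hQ2 t
    have hci : Integrable (SPMap.corr Q₀ X μ) (μ.map T) := by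
      rw [hcorr]
      exact (hint.integral_prod_left.sub (integrable_const _)).div_const _
    obtain ⟨h1, h2⟩ := SPMap.integral_exp_mul_eq_of_law hθ hTm hT.law hci
    refine ⟨h1, h2.trans ?_⟩
    rw [hcorr, integral_div, integral_sub hint.integral_prod_left (integrable_const _), ← hmix,
      hgamma]
    simp only [integral_const, probReal_univ, one_smul]
    field_simp
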